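/- **Conventions (continuous logic).** Let $\mathcal L$ be an arbitrary one-sorted continuous signature, normalized so that metrics have diameter at most $1$ and predicates take values in $[0,1]$; every function and predicate symbol has an arity and a modulus of uniform continuity $(0,1]\to(0,1]$. An $\mathcal L$-structure is a non-empty complete metric space of diameter at most $1$ with interpretations of the symbols respecting these moduli. Atomic formulas are $d(t_1,t_2)$ and $P(t_1,\dots,t_k)$ with $t_i$ terms; formulas are built from these by all continuous connectives $[0,1]^k\to[0,1]$ and the quantifiers $\sup_x$, $\inf_x$. A closed condition is an expression "$\sigma=0$" with $\sigma$ a sentence, and an $\mathcal L$-theory is a set of closed $\mathcal L$-conditions. A closed condition $\sigma=0$ is *universal* (resp. *existential*) if $\sigma$ is of the form $\sup_{\vec x}\varphi(\vec x)$ (resp. $\inf_{\vec x}\varphi(\vec x)$) with $\varphi$ quantifier-free. A set $A$ of closed conditions *axiomatizes* $T$ if $A$ and $T$ have the same models; $T$ is *universally axiomatizable* if some set of universal conditions axiomatizes it. An $\mathcal L$-theory $T$ is - *complete* if the closed conditions true in all models of $T$ are exactly those true in some fixed $\mathcal L$-structure; - *model-complete* if every embedding between models of $T$ is elementary, i.e.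 preserves the values of all formulas; - *primitive* if there are a set $\Gamma$ of universal conditions and a set $\Delta$ of existential conditions such that $\Gamma\cup\Delta$ axiomatizes $T$. $T$ has *quantifier elimination* if for every formula $\varphi(\vec x)$ and every $\epsilon>0$ there is a quantifier-free formula $\psi(\vec x)$ such that $|\varphi^{\mathcal N}(\vec a)-\psi^{\mathcal N}(\vec a)|\le\epsilon$ for all $\mathcal N\models T$ and all tuples $\vec a$ from $\mathcal N$. For an $\mathcal L$-structure $\mathcal M$, let $\mathcal L(\mathcal M)$ be $\mathcal L$ with a new constant symbol for each element of $\mathcal M$. Let $T_{\mathcal M}$ be the set of all closed $\mathcal L(\mathcal M)$-conditions true in $\mathcal M$ (each new constant naming its element), and let the atomic diagram $D(\mathcal M)$ be the set of all conditions $|\sigma-r|=0$, where $\sigma$ is an atomic $\mathcal L(\mathcal M)$-sentence and $r=\sigma^{\mathcal M}$. **Proposition.** Let $T$ be a complete, model-complete, primitive $\mathcal L$-theory and let $\mathcal M\models T$. Then: 1. $T_{\mathcal M}$ is universally axiomatizable. 2. More precisely, whenever $\Gamma$ is a set of universal $\mathcal L$-conditions and $\Delta$ a set of existential $\mathcal L$-conditions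 such that $\Gamma\cup\Delta$ axiomatizes $T$, the set $\Gamma\cup D(\mathcal M)$ axiomatizes $T_{\mathcal M}$. 3. If $T$ has quantifier elimination, then so does $T_{\mathcal M}$. -/

import Mathlib

universe u v w

namespace ContLogic

/-- A modulus of uniform continuity: a function `(0,1] → (0,1]`. -/
abbrev Modulus : Type := Set.Ioc (0 : ℝ) 1 → Set.Ioc (0 : ℝ) 1

/-- A (one-sorted) signature for metric structures, normalized as usual: the metric has diameter
at most `1` and predicates take values in `[0,1]`.  Each function or predicate symbol comes with
an arity and a modulus of uniform continuity.  Constant symbols are function symbols of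
arity `0`. -/
structure Signature where
  /-- function symbols of each arity -/
  Func : ℕ → Type u
  /-- predicate symbols of each arity -/
  Pred : ℕ → Type v
  /-- the modulus attached to a function symbol -/
  funcMod : ∀ {n : ℕ}, Func n → Modulus
  /-- the modulus attached to a predicate symbol -/
  predMod : ∀ {n : ℕ}, Pred n → Modulus

/-- An `L`-structure: a non-empty complete metric space of diameter at most `1`, with
interpretations of the symbols that respect the prescribed moduli.  The distance of two tuples is
the maximum of the coordinate distances, so `dist (tuples) < δ` is written coordinatewise
(moduli are positive, so the empty tuple causes no trouble). -/
structure Structure (L : Signature.{u, v}) where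
  /-- the underlying space -/
  Carrier : Type w
  [metric : MetricSpace Carrier]
  [complete : CompleteSpace Carrier]
  [nonempty : Nonempty Carrier]
  dist_le_one : ∀ x y : Carrier, dist x y ≤ 1
  /-- interpretation of function symbols -/
  func : ∀ {n : ℕ}, L.Func n → (Fin n → Carrier) → Carrier
  func_modulus : ∀ {n : ℕ} (f : L.Func n) (ε : Set.Ioc (0 : ℝ) 1) (a b : Fin n → Carrier),
    (∀ i, dist (a i) (b i) < (L.funcMod f ε : ℝ)) → dist (func f a) (func f b) ≤ (ε : ℝ)
  /-- interpretation of predicate symbols -/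
  pred : ∀ {n : ℕ}, L.Pred n → (Fin n → Carrier) → unitInterval
  pred_modulus : ∀ {n : ℕ} (P : L.Pred n) (ε : Set.Ioc (0 : ℝ) 1) (a b : Fin n → Carrier),
    (∀ i, dist (a i) (b i) < (L.predMod P ε : ℝ)) →
      |(pred P a : ℝ) - (pred P b : ℝ)| ≤ (ε : ℝ)

attribute [instance] Structure.metric Structure.complete Structure.nonempty

/-- `L`-terms in the variables `x₀, …, xₙ₋₁`. -/
inductive Term (L : Signature.{u, v}) (n : ℕ) : Type u
  | var : Fin n → Term L n
  | func {k : ℕ} : L.Func k → (Fin k → Term L n) → Term L n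

/-- `L`-formulas with free variables among `x₀, …, xₙ₋₁`.  The connectives are all continuous
functions `[0,1]ᵏ → [0,1]`; the quantifiers `sup` and `inf` bind the last variable. -/
inductive Formula (L : Signature.{u, v}) : ℕ → Type (max u v)
  | dist {n : ℕ} : Term L n → Term L n → Formula L n
  | pred {n k : ℕ} : L.Pred k → (Fin k → Term L n) → Formula L n
  | conn {n k : ℕ} : C(Fin k → unitInterval, unitInterval) → (Fin k → Formula L n) → Formula L n
  | sup {n : ℕ} : Formula L (n + 1) → Formula L n
  | inf {n : ℕ} : Formula L (n + 1) → Formula L n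

variable {L : Signature.{u, v}}

/-- The value of a term at a tuple. -/
def Term.eval (M : Structure.{u, v, w} L) {n : ℕ} (a : Fin n → M.Carrier) : Term L n → M.Carrier
  | .var i => a i
  | .func f ts => M.func f fun i => (ts i).eval M a

/-- The value `φ^M(a)` of a formula at a tuple, an element of `[0,1]`.  The supremum and infimum
are those of the complete lattice `[0,1]`. -/
noncomputable def Formula.eval (M : Structure.{u, v, w} L) :
    {n : ℕ} → Formula L n → (Fin n → M.Carrier) → unitInterval
  | _, .dist s t, a => ⟨Dist.dist (s.eval M a) (t.eval M a), dist_nonneg, M.dist_le_one _ _⟩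
  | _, .pred P ts, a => M.pred P fun i => (ts i).eval M a
  | _, .conn c φs, a => c fun i => (φs i).eval M a
  | _, .sup φ, a => ⨆ x : M.Carrier, φ.eval M (Fin.snoc (α := fun _ => M.Carrier) a x)
  | _, .inf φ, a => ⨅ x : M.Carrier, φ.eval M (Fin.snoc (α := fun _ => M.Carrier) a x)

/-- Sentences: formulas without free variables. -/
abbrev Sentence (L : Signature.{u, v}) : Type (max u v) := Formula L 0

/-- The value `σ^M` of a sentence. -/
noncomputable def Sentence.value (M : Structure.{u, v, w} L) (σ : Sentence L) : unitInterval :=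
  Formula.eval M σ Fin.elim0

/-- Atomic formulas. -/
def Formula.IsAtomic : {n : ℕ} → Formula L n → Prop
  | _, .dist _ _ => True
  | _, .pred _ _ => True
  | _, _ => False

/-- Quantifier-free formulas. -/
def Formula.IsQF : {n : ℕ} → Formula L n → Prop
  | _, .dist _ _ => True
  | _, .pred _ _ => True
  | _, .conn _ φs => ∀ i, (φs i).IsQF
  | _, .sup _ => False
  | _, .inf _ => False

/-- `sup_{x₀} ⋯ sup_{xₙ₋₁} φ`. -/
def Formula.supAll : {n : ℕ} → Formula L n → Sentence L
  | 0, φ => φ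
  | _ + 1, φ => φ.sup.supAll

/-- `inf_{x₀} ⋯ inf_{xₙ₋₁} φ`. -/
def Formula.infAll : {n : ℕ} → Formula L n → Sentence L
  | 0, φ => φ
  | _ + 1, φ => φ.inf.infAll

/-- Universal sentences: `sup_x φ(x)` with `φ` quantifier-free and `x` a finite tuple. -/
def Sentence.IsUniversal (σ : Sentence L) : Prop :=
  ∃ (n : ℕ) (φ : Formula L n), φ.IsQF ∧ σ = φ.supAll

/-- Existential sentences: `inf_x φ(x)` with `φ` quantifier-free and `x` a finite tuple. -/
def Sentence.IsExistential (σ : Sentence L) : Prop :=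
  ∃ (n : ℕ) (φ : Formula L n), φ.IsQF ∧ σ = φ.infAll

/-- A theory is a set of closed conditions `σ = 0`; the condition `σ = 0` is represented by the
sentence `σ`. -/
abbrev Theory (L : Signature.{u, v}) : Type (max u v) := Set (Sentence L)

/-- `M ⊨ T`: every condition `σ = 0` of `T` is true in `M`. -/
def Structure.Models (M : Structure.{u, v, w} L) (T : Theory L) : Prop :=
  ∀ σ ∈ T, Sentence.value M σ = 0

/-- `Th(M)`: the set of all closed conditions true in `M`. -/
def Structure.theory (M : Structure.{u, v, w} L) : Theory L :=
  {σ | Sentence.value M σ = 0}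

/-- Embeddings of `L`-structures (isometries onto substructures). -/
structure Embedding (M N : Structure.{u, v, w} L) where
  /-- the underlying map -/
  toFun : M.Carrier → N.Carrier
  isometry : Isometry toFun
  map_func : ∀ {n : ℕ} (f : L.Func n) (a : Fin n → M.Carrier),
    toFun (M.func f a) = N.func f fun i => toFun (a i)
  map_pred : ∀ {n : ℕ} (P : L.Pred n) (a : Fin n → M.Carrier),
    N.pred P (fun i => toFun (a i)) = M.pred P a

/-- An embedding is elementary if it preserves the values of all formulas. -/
def Embedding.IsElementary {M N : Structure.{u, v, w} L} (j : Embedding M N) : Prop :=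
  ∀ (n : ℕ) (φ : Formula L n) (a : Fin n → M.Carrier),
    φ.eval N (fun i => j.toFun (a i)) = φ.eval M a

/-- `A` axiomatizes `T`: the two sets of closed conditions have the same models. -/
def Theory.Axiomatizes (A T : Theory L) : Prop :=
  ∀ N : Structure.{u, v, w} L, N.Models A ↔ N.Models T

/-- `T` is complete: the closed conditions that follow from `T` form `Th(M)` for some `M`. -/
def Theory.IsComplete (T : Theory L) : Prop :=
  ∃ M : Structure.{u, v, w} L, ∀ σ : Sentence L,
    (∀ N : Structure.{u, v, w} L, N.Models T → Sentence.value N σ = 0) ↔ σ ∈ M.theory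

/-- `T` is model-complete: every embedding between models of `T` is elementary. -/
def Theory.IsModelComplete (T : Theory L) : Prop :=
  ∀ (M N : Structure.{u, v, w} L), M.Models T → N.Models T →
    ∀ j : Embedding M N, j.IsElementary

/-- `T` is primitive: it is axiomatized by a set of universal conditions together with a set of
existential conditions. -/
def Theory.IsPrimitive (T : Theory L) : Prop :=
  ∃ Γ Δ : Theory L, (∀ σ ∈ Γ, Sentence.IsUniversal σ) ∧ (∀ σ ∈ Δ, Sentence.IsExistential σ) ∧
    Theory.Axiomatizes.{u, v, w} (Γ ∪ Δ) T

/-- `T` has a universal axiomatization. -/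
def Theory.IsUniversallyAxiomatizable (T : Theory L) : Prop :=
  ∃ Γ : Theory L, (∀ σ ∈ Γ, Sentence.IsUniversal σ) ∧ Theory.Axiomatizes.{u, v, w} Γ T

/-- `T` has quantifier elimination: modulo `T`, every formula is uniformly approximable by
quantifier-free formulas in the same free variables. -/
def Theory.HasQE (T : Theory L) : Prop :=
  ∀ (n : ℕ) (φ : Formula L n) (ε : ℝ), 0 < ε → ∃ ψ : Formula L n, ψ.IsQF ∧
    ∀ N : Structure.{u, v, w} L, N.Models T → ∀ a : Fin n → N.Carrier,
      |(φ.eval N a : ℝ) - (ψ.eval N a : ℝ)| ≤ ε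

/-- New symbols: one of arity `0` for each element of `A`, none of positive arity. -/
inductive ConstSymb (A : Type w) : ℕ → Type w
  | const : A → ConstSymb A 0

/-- The signature `L(A)`: `L` with a new constant symbol for each element of `A`.  (The modulus of
a constant symbol is irrelevant.) -/
def Signature.withConstants (L : Signature.{u, v}) (A : Type w) : Signature.{max u w, v} where
  Func n := L.Func n ⊕ ConstSymb A n
  Pred := L.Pred
  funcMod f := Sum.elim (fun g => L.funcMod g) (fun _ => id) f
  predMod P := L.predMod P

/-- An `L`-term as an `L(A)`-term. -/
def Term.lift (A : Type w) {n : ℕ} : Term L n → Term (L.withConstants A) n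
  | .var i => .var i
  | .func f ts => .func (L := L.withConstants A) (Sum.inl f) fun i => (ts i).lift A

/-- An `L`-formula as an `L(A)`-formula. -/
def Formula.lift (A : Type w) : {n : ℕ} → Formula L n → Formula (L.withConstants A) n
  | _, .dist s t => .dist (s.lift A) (t.lift A)
  | _, .pred P ts => .pred (L := L.withConstants A) P fun i => (ts i).lift A
  | _, .conn c φs => .conn c fun i => (φs i).lift A
  | _, .sup φ => .sup (φ.lift A)
  | _, .inf φ => .inf (φ.lift A)

/-- The interpretation in `M` of the function symbols of `L(M)`: a new constant names itself. -/
def Structure.expandFunc (M : Structure.{u, v, w} L) :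
    {n : ℕ} → (L.withConstants M.Carrier).Func n → (Fin n → M.Carrier) → M.Carrier
  | _, .inl f, a => M.func f a
  | _, .inr (.const c), _ => c

/-- `M` as an `L(M)`-structure. -/
def Structure.expand (M : Structure.{u, v, w} L) :
    Structure.{max u w, v, w} (L.withConstants M.Carrier) where
  Carrier := M.Carrier
  dist_le_one := M.dist_le_one
  func f a := M.expandFunc f a
  func_modulus := by
    rintro n (f | ⟨c⟩) ε a b h
    · exact M.func_modulus f ε a b h
    · cases c
      exact (dist_self _).trans_le ε.2.1.le
  pred P a := M.pred P a
  pred_modulus P ε a b h := M.pred_modulus P ε a b h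

/-- `T_M`, the `L(M)`-theory of `M`. -/
def Structure.elemDiagram (M : Structure.{u, v, w} L) : Theory (L.withConstants M.Carrier) :=
  M.expand.theory

/-- The connective `x ↦ |x - r|`. -/
def absSub (r : unitInterval) : C(Fin 1 → unitInterval, unitInterval) where
  toFun x := ⟨|(x 0 : ℝ) - r|, abs_nonneg _, abs_sub_le_iff.2
    ⟨by linarith [(x 0).2.2, r.2.1], by linarith [(x 0).2.1, r.2.2]⟩⟩
  continuous_toFun := by fun_prop

/-- The atomic diagram of `M`: all conditions `|σ - r| = 0`, i.e. `σ = r`, where `σ` is an atomic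
`L(M)`-sentence and `r = σ^M`. -/
def Structure.atomicDiagram (M : Structure.{u, v, w} L) : Theory (L.withConstants M.Carrier) :=
  {τ | ∃ σ : Sentence (L.withConstants M.Carrier), Formula.IsAtomic σ ∧
    τ = .conn (absSub (Sentence.value M.expand σ)) (fun _ => σ)}

end ContLogic

/-! The atomic diagram says exactly that the constants of a model `N` trace out a copy of `M`, so
`N` satisfies it only if `a ↦ N.const a` embeds `M` into the `L`-reduct of `N`
(`Structure.Models.embedding`). If moreover the reduct satisfies `Γ`, then it satisfies `Δ` for
free: existential conditions true in `M` pass up along embeddings. Hence the reduct is a model of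
`T`, and model-completeness makes the embedding elementary.

Elementarity is all that `T_M` asks for, because an `L(M)`-sentence is an `L`-formula evaluated at a
finite tuple of constants (`Formula.exists_eval_append`). Conversely, `T_M` contains both `Γ` and
the atomic diagram. The diagram is quantifier-free, so the axioms obtained are universal.

Quantifier elimination transfers by the same trade of constants for variables: eliminate in `T` with
the constants as parameters, then substitute them back. -/

namespace ContLogic

variable {L : Signature.{u, v}}

/-! ### Reducts, and trading new constants for variables. -/

section Constants

variable {A : Type w}

/-- The `L`-reduct of an `L(A)`-structure. -/
def Structure.reduct (N : Structure (L.withConstants A)) : Structure L where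
  Carrier := N.Carrier
  dist_le_one := N.dist_le_one
  func f a := N.func (Sum.inl f) a
  func_modulus f ε a b h := N.func_modulus (Sum.inl f) ε a b h
  pred P a := N.pred P a
  pred_modulus P ε a b h := N.pred_modulus P ε a b h

/-- The element of an `L(A)`-structure named by a new constant. -/
def Structure.const (N : Structure (L.withConstants A)) (c : A) : N.Carrier :=
  N.func (Sum.inr (.const c)) Fin.elim0

/-- The term consisting of a new constant. -/
def Term.const (L : Signature) {n : ℕ} (c : A) : Term (L.withConstants A) n :=
  .func (L := L.withConstants A) (Sum.inr (.const c)) Fin.elim0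

theorem Term.eval_const (N : Structure (L.withConstants A)) {n : ℕ} (a : Fin n → N.Carrier)
    (c : A) : (Term.const L c).eval N a = N.const c :=
  congrArg (N.func _) (Subsingleton.elim _ _)

theorem Term.eval_lift (N : Structure (L.withConstants A)) {n : ℕ} (t : Term L n)
    (a : Fin n → N.Carrier) : (t.lift A).eval N a = t.eval N.reduct a := by
  induction t with
  | var i => rfl
  | func f ts ih => exact congrArg (N.func _) (funext ih)

theorem Formula.eval_lift (N : Structure (L.withConstants A)) {n : ℕ} (φ : Formula L n)
    (a : Fin n → N.Carrier) : (φ.lift A).eval N a = φ.eval N.reduct a := by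
  induction φ with
  | dist s t => simp only [Formula.lift, Formula.eval, Term.eval_lift]; rfl
  | pred P ts => exact congrArg (N.pred _) (funext fun i => Term.eval_lift N (ts i) a)
  | conn c φs ih => exact congrArg c (funext fun i => ih i a)
  | sup φ ih => exact iSup_congr fun x => ih _
  | inf φ ih => exact iInf_congr fun x => ih _

theorem Formula.value_lift (N : Structure (L.withConstants A)) (σ : Sentence L) :
    Sentence.value N (Formula.lift A σ) = Sentence.value N.reduct σ :=
  Formula.eval_lift N σ _

theorem Formula.IsQF.lift {n : ℕ} {φ : Formula L n} (h : φ.IsQF) : (φ.lift A).IsQF := by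
  induction φ with
  | dist s t => trivial
  | pred P ts => trivial
  | conn c φs ih => exact fun i => ih i (h i)
  | sup φ ih => exact h
  | inf φ ih => exact h

theorem Formula.lift_supAll {n : ℕ} (φ : Formula L n) :
    φ.supAll.lift A = (φ.lift A).supAll := by
  induction n with
  | zero => rfl
  | succ n ih => exact ih φ.sup

theorem Sentence.IsUniversal.lift {σ : Sentence L} (h : Sentence.IsUniversal σ) :
    Sentence.IsUniversal (Formula.lift A σ) := by
  obtain ⟨n, φ, hφ, rfl⟩ := h
  exact ⟨n, φ.lift A, hφ.lift, φ.lift_supAll⟩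

/-- The new constants occurring in a term. -/
def Term.constants {n : ℕ} : Term (L.withConstants A) n → Set A
  | .var _ => ∅
  | .func (.inl _) ts => ⋃ i, (ts i).constants
  | .func (.inr (.const c)) _ => {c}

/-- The new constants occurring in a formula. -/
def Formula.constants : {n : ℕ} → Formula (L.withConstants A) n → Set A
  | _, .dist s t => s.constants ∪ t.constants
  | _, .pred _ ts => ⋃ i, (ts i).constants
  | _, .conn _ φs => ⋃ i, (φs i).constants
  | _, .sup φ => φ.constants
  | _, .inf φ => φ.constants

/-- Arities are finite, so one finite tuple can list all the new constants in a term or formula. -/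
theorem Term.finite_constants {n : ℕ} (t : Term (L.withConstants A) n) : t.constants.Finite := by
  induction t with
  | var i => exact Set.finite_empty
  | func f ts ih =>
    rcases f with f | c
    · exact Set.finite_iUnion ih
    · cases c with | const c =>
      exact Set.finite_singleton c

theorem Formula.finite_constants {n : ℕ} (φ : Formula (L.withConstants A) n) :
    φ.constants.Finite := by
  induction φ with
  | dist s t => exact s.finite_constants.union t.finite_constants
  | pred P ts => exact Set.finite_iUnion fun i => (ts i).finite_constants
  | conn c φs ih => exact Set.finite_iUnion ih
  | sup φ ih => exact ih
  | inf φ ih => exact ih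

/-- An `L(A)`-term with constants among `c` is an `L`-term with `c` substituted for the first
variables. -/
theorem Term.exists_eval_append {k : ℕ} (c : Fin k → A) {n : ℕ} (t : Term (L.withConstants A) n)
    (ht : t.constants ⊆ Set.range c) :
    ∃ t' : Term L (k + n), ∀ (N : Structure (L.withConstants A)) (a : Fin n → N.Carrier),
      t.eval N a = t'.eval N.reduct (Fin.append (fun i => N.const (c i)) a) := by
  induction t with
  | var i => exact ⟨.var (Fin.natAdd k i), fun N a => (Fin.append_right _ _ _).symm⟩
  | func f ts ih =>
    rcases f with f | b
    · choose ts' h using fun i => ih i ((Set.subset_iUnion _ i).trans ht)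
      exact ⟨.func f ts', fun N a => congrArg (N.func _) (funext fun i => h i N a)⟩
    · cases b with | const b =>
      obtain ⟨i, rfl⟩ := ht rfl
      refine ⟨.var (Fin.castAdd n i), fun N a => ?_⟩
      refine Eq.trans ?_ (Fin.append_left (fun i => N.const (c i)) a i).symm
      exact congrArg (N.func _) (Subsingleton.elim _ _)

/-- An `L(A)`-formula with constants among `c` is an `L`-formula with `c` substituted for the
first variables. -/
theorem Formula.exists_eval_append_of_subset {k : ℕ} (c : Fin k → A) {n : ℕ}
    (φ : Formula (L.withConstants A) n) (hφ : φ.constants ⊆ Set.range c) :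
    ∃ φ' : Formula L (k + n), ∀ (N : Structure (L.withConstants A)) (a : Fin n → N.Carrier),
      φ.eval N a = φ'.eval N.reduct (Fin.append (fun i => N.const (c i)) a) := by
  induction φ with
  | dist s t =>
    obtain ⟨s', hs⟩ := s.exists_eval_append c (Set.subset_union_left.trans hφ)
    obtain ⟨t', ht⟩ := t.exists_eval_append c (Set.subset_union_right.trans hφ)
    exact ⟨.dist s' t', fun N a =>
      Subtype.ext (congrArg₂ (Dist.dist (α := N.Carrier)) (hs N a) (ht N a))⟩
  | pred P ts =>
    choose ts' h using fun i =>
      (ts i).exists_eval_append c ((Set.subset_iUnion _ i).trans hφ)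
    exact ⟨.pred (L := L) P ts', fun N a => congrArg (N.pred _) (funext fun i => h i N a)⟩
  | conn f φs ih =>
    choose φs' h using fun i => ih i ((Set.subset_iUnion _ i).trans hφ)
    exact ⟨.conn f φs', fun N a => congrArg f (funext fun i => h i N a)⟩
  | sup φ ih =>
    obtain ⟨φ', h⟩ := ih hφ
    -- Quantifiers bind the last variable. With the constants in front, `k + (n + 1)` is `(k + n) +
    -- 1` by definition and the bound variable stays last.
    exact ⟨.sup φ', fun N a => iSup_congr fun x =>
      (h N _).trans (congrArg (φ'.eval N.reduct) (Fin.append_snoc _ a x))⟩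
  | inf φ ih =>
    obtain ⟨φ', h⟩ := ih hφ
    exact ⟨.inf φ', fun N a => iInf_congr fun x =>
      (h N _).trans (congrArg (φ'.eval N.reduct) (Fin.append_snoc _ a x))⟩

/-- The tuple `c` and the formula `φ'` are chosen before `N`. This uniformity allows `M.expand` and
any other `L(A)`-structure to be compared through the same `L`-formula. -/
theorem Formula.exists_eval_append {n : ℕ} (φ : Formula (L.withConstants A) n) :
    ∃ (k : ℕ) (c : Fin k → A) (φ' : Formula L (k + n)),
      ∀ (N : Structure (L.withConstants A)) (a : Fin n → N.Carrier),
        φ.eval N a = φ'.eval N.reduct (Fin.append (fun i => N.const (c i)) a) := by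
  obtain ⟨k, c, hc⟩ := φ.finite_constants.fin_param
  exact ⟨k, c, φ.exists_eval_append_of_subset c hc.2.ge⟩

/-- Substitution of `L(A)`-terms into an `L`-term. -/
def Term.subst {m n : ℕ} (s : Fin m → Term (L.withConstants A) n) :
    Term L m → Term (L.withConstants A) n
  | .var i => s i
  | .func f ts => .func (L := L.withConstants A) (Sum.inl f) fun i => (ts i).subst s

theorem Term.eval_subst {m n : ℕ} (s : Fin m → Term (L.withConstants A) n) (t : Term L m)
    (N : Structure (L.withConstants A)) (a : Fin n → N.Carrier) :
    (t.subst s).eval N a = t.eval N.reduct fun i => (s i).eval N a := by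
  induction t with
  | var i => rfl
  | func f ts ih => exact congrArg (N.func _) (funext ih)

/-- Without binders there is no capture to avoid, so substitution acts on the terms of the atomic
subformulas alone. -/
theorem Formula.IsQF.exists_subst {m n : ℕ} {ψ : Formula L m} (hψ : ψ.IsQF)
    (s : Fin m → Term (L.withConstants A) n) :
    ∃ ψ' : Formula (L.withConstants A) n, ψ'.IsQF ∧
      ∀ (N : Structure (L.withConstants A)) (a : Fin n → N.Carrier),
        ψ'.eval N a = ψ.eval N.reduct fun i => (s i).eval N a := by
  induction ψ with
  | dist t u =>
    refine ⟨.dist (t.subst s) (u.subst s), trivial, fun N a => ?_⟩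
    simp only [Formula.eval, Term.eval_subst]
    rfl
  | pred P ts =>
    exact ⟨.pred (L := L.withConstants A) P fun i => (ts i).subst s, trivial,
      fun N a => congrArg (N.pred _) (funext fun i => (ts i).eval_subst s N a)⟩
  | conn c φs ih =>
    choose φs' hq h using fun i => ih i (hψ i) s
    exact ⟨.conn c φs', hq, fun N a => congrArg c (funext fun i => h i N a)⟩
  | sup φ ih => exact hψ.elim
  | inf φ ih => exact hψ.elim

end Constants

/-! ### Embeddings and existential conditions. -/

section Embedding

variable {M N : Structure L}

theorem Embedding.eval_term (j : Embedding M N) {n : ℕ} (t : Term L n) (a : Fin n → M.Carrier) :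
    t.eval N (fun i => j.toFun (a i)) = j.toFun (t.eval M a) := by
  induction t with
  | var i => rfl
  | func f ts ih => exact (congrArg (N.func f) (funext ih)).trans (j.map_func _ _).symm

theorem Embedding.eval_of_isQF (j : Embedding M N) {n : ℕ} {φ : Formula L n} (hφ : φ.IsQF)
    (a : Fin n → M.Carrier) : φ.eval N (fun i => j.toFun (a i)) = φ.eval M a := by
  induction φ with
  | dist s t => exact Subtype.ext (by simp [Formula.eval, j.eval_term, j.isometry.dist_eq])
  | pred P ts =>
    exact (congrArg (N.pred P) (funext fun i => j.eval_term (ts i) a)).trans (j.map_pred _ _)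
  | conn c φs ih => exact congrArg c (funext fun i => ih i (hφ i) a)
  | sup φ ih => exact hφ.elim
  | inf φ ih => exact hφ.elim

/-- The infimum over `N` ranges over at least the images of the tuples from `M`. The hypothesis is
an inequality because, unlike equality, it is inherited by `φ.inf` in the induction. -/
theorem Formula.value_infAll_le (f : M.Carrier → N.Carrier) {n : ℕ} (φ : Formula L n)
    (h : ∀ a : Fin n → M.Carrier, φ.eval N (fun i => f (a i)) ≤ φ.eval M a) :
    Sentence.value N φ.infAll ≤ Sentence.value M φ.infAll := by
  induction n with
  | zero =>
    have := h Fin.elim0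
    rwa [Subsingleton.elim (fun i => f (Fin.elim0 i)) Fin.elim0] at this
  | succ n ih =>
    refine ih φ.inf fun a => le_iInf fun x => (iInf_le _ (f x)).trans ?_
    refine le_of_eq_of_le (congrArg (φ.eval N) ?_) (h _)
    exact (Fin.comp_snoc f a x).symm

/-- A larger structure can only lower an infimum, and `0` is the least value. -/
theorem Sentence.IsExistential.value_eq_zero {σ : Sentence L} (hσ : Sentence.IsExistential σ)
    (j : Embedding M N) (h : Sentence.value M σ = 0) : Sentence.value N σ = 0 := by
  obtain ⟨n, φ, hφ, rfl⟩ := hσ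
  have := φ.value_infAll_le j.toFun fun a => (j.eval_of_isQF hφ a).le
  exact le_antisymm (this.trans h.le) unitInterval.nonneg'

end Embedding

/-! ### The diagrams of `M` and the theory `T_M`. -/

section Diagram

variable {M : Structure L}

theorem value_conn_absSub_eq_zero_iff {N : Structure L} (r : unitInterval) (σ : Sentence L) :
    Sentence.value N (.conn (absSub r) fun _ => σ) = 0 ↔ Sentence.value N σ = r := by
  rw [Subtype.ext_iff, Subtype.ext_iff]
  exact abs_eq_zero.trans sub_eq_zero

theorem Structure.Models.value_eq_of_isAtomic {N : Structure (L.withConstants M.Carrier)}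
    (hN : N.Models M.atomicDiagram) {σ : Sentence (L.withConstants M.Carrier)}
    (hσ : Formula.IsAtomic σ) : Sentence.value N σ = Sentence.value M.expand σ :=
  (value_conn_absSub_eq_zero_iff _ _).1 (hN _ ⟨σ, hσ, rfl⟩)

theorem Structure.Models.dist_eval {N : Structure (L.withConstants M.Carrier)}
    (hN : N.Models M.atomicDiagram) (s t : Term (L.withConstants M.Carrier) 0) :
    dist (s.eval N Fin.elim0) (t.eval N Fin.elim0) =
      dist (s.eval M.expand Fin.elim0) (t.eval M.expand Fin.elim0) :=
  congrArg Subtype.val (hN.value_eq_of_isAtomic (σ := .dist s t) trivial)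

/-- A model of the atomic diagram of `M` contains a copy of `M`. -/
def Structure.Models.embedding {M : Structure.{u, v, max u w} L}
    {N : Structure.{max u w, v, max u w} (L.withConstants M.Carrier)}
    (hN : N.Models M.atomicDiagram) : Embedding M N.reduct where
  toFun := N.const
  isometry := Isometry.of_dist_eq fun a b => by
    have := hN.dist_eval (Term.const L a) (Term.const L b)
    rwa [Term.eval_const, Term.eval_const, Term.eval_const, Term.eval_const] at this
  map_func f a := by
    -- The constant naming `f(a)` and the term `f` applied to the constants naming `a` are at
    -- distance `0` in `M`, hence in `N`, hence equal there.
    have h := hN.dist_eval (Term.const L (M.func f a))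
      (.func (L := L.withConstants M.Carrier) (Sum.inl f) fun i => Term.const L (a i))
    simp only [Term.eval, Term.eval_const] at h
    exact dist_eq_zero.1 (h.trans (dist_self (M.func f a)))
  map_pred P a := by
    have h := hN.value_eq_of_isAtomic
      (σ := .pred (L := L.withConstants M.Carrier) P fun i => Term.const L (a i)) trivial
    simp only [Sentence.value, Formula.eval, Term.eval_const] at h
    exact h

theorem Structure.models_atomicDiagram_of_elemDiagram
    {N : Structure (L.withConstants M.Carrier)} (hN : N.Models M.elemDiagram) :
    N.Models M.atomicDiagram := by
  rintro _ ⟨σ, hσ, rfl⟩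
  exact hN _ ((value_conn_absSub_eq_zero_iff _ _).2 rfl)

theorem Structure.Models.reduct_of_elemDiagram {T : Theory L} (hM : M.Models T)
    {N : Structure (L.withConstants M.Carrier)} (hN : N.Models M.elemDiagram) :
    N.reduct.Models T := fun σ hσ =>
  (Formula.value_lift N σ).symm.trans (hN _ ((Formula.value_lift M.expand σ).trans (hM σ hσ)))

/-- A sentence of `T_M` is an `L`-formula at a finite tuple from `M`. By `hc`, its value in `N` is
that of the same formula at the image tuple, which elementarity preserves. -/
theorem Embedding.IsElementary.models_elemDiagram {M : Structure.{u, v, max u w} L}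
    {N : Structure.{max u w, v, max u w} (L.withConstants M.Carrier)}
    {j : Embedding M N.reduct} (hj : j.IsElementary) (hc : j.toFun = N.const) :
    N.Models M.elemDiagram := by
  intro σ hσ
  obtain ⟨k, c, φ, h⟩ := Formula.exists_eval_append σ
  have hM : Sentence.value M.expand σ = φ.eval M c := by
    refine (h M.expand Fin.elim0).trans (congrArg (φ.eval M) ?_)
    exact Fin.append_elim0 c
  have hN : Sentence.value N σ = φ.eval N.reduct fun i => j.toFun (c i) := by
    refine (h N Fin.elim0).trans (congrArg (φ.eval N.reduct) ?_)
    rw [hc]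
    exact Fin.append_elim0 _
  rw [hN, hj, ← hM]
  exact hσ

theorem Theory.IsModelComplete.axiomatizes_elemDiagram {T : Theory L}
    (hmc : Theory.IsModelComplete.{u, v, max u w} T) {M : Structure.{u, v, max u w} L}
    (hM : M.Models T) {Γ Δ : Theory L} (hΔ : ∀ σ ∈ Δ, Sentence.IsExistential σ)
    (hT : Theory.Axiomatizes.{u, v, max u w} (Γ ∪ Δ) T) :
    Theory.Axiomatizes.{max u w, v, max u w}
      (Formula.lift M.Carrier '' Γ ∪ M.atomicDiagram) M.elemDiagram := by
  have hMΓΔ := (hT M).2 hM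
  intro N
  constructor
  · intro hN
    have hD : N.Models M.atomicDiagram := fun σ hσ => hN σ (Or.inr hσ)
    have hNT : N.reduct.Models T := by
      refine (hT _).1 ?_
      rintro σ (hσ | hσ)
      · exact (Formula.value_lift N σ).symm.trans (hN _ (Or.inl ⟨σ, hσ, rfl⟩))
      -- `Δ` need not be among the axioms: it holds in `M` and is carried up by the embedding.
      · exact (hΔ σ hσ).value_eq_zero hD.embedding (hMΓΔ σ (Or.inr hσ))
    exact (hmc M N.reduct hM hNT hD.embedding).models_elemDiagram rfl
  · rintro hN σ (⟨τ, hτ, rfl⟩ | hσ)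
    · exact (Formula.value_lift N τ).trans
        (Structure.Models.reduct_of_elemDiagram hMΓΔ hN τ (Or.inl hτ))
    · exact Structure.models_atomicDiagram_of_elemDiagram hN σ hσ

/-- The block of quantifiers is empty: a connective applied to an atomic sentence is already
quantifier-free. -/
theorem Structure.isUniversal_of_mem_atomicDiagram {σ : Sentence (L.withConstants M.Carrier)}
    (hσ : σ ∈ M.atomicDiagram) : Sentence.IsUniversal σ := by
  obtain ⟨τ, hτ, rfl⟩ := hσ
  refine ⟨0, _, fun _ => ?_, rfl⟩
  cases τ with
  | dist s t => trivial
  | pred P ts => trivial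
  | conn c φs => exact hτ.elim
  | sup φ => exact hτ.elim
  | inf φ => exact hτ.elim

theorem Theory.HasQE.elemDiagram {T : Theory L} (hQE : Theory.HasQE.{u, v, max u w} T)
    {M : Structure.{u, v, max u w} L} (hM : M.Models T) :
    Theory.HasQE.{max u w, v, max u w} M.elemDiagram := by
  intro n φ ε hε
  obtain ⟨k, c, φ', hφ'⟩ := φ.exists_eval_append
  obtain ⟨ψ, hψ, happrox⟩ := hQE _ φ' ε hε
  -- The first `k` variables become the constants again; the remaining `n` stay variables. The bound
  -- `ε` holds at all tuples, in particular at those beginning with the constants.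
  obtain ⟨ψ', hψ', heval⟩ :=
    hψ.exists_subst (Fin.append (fun i => Term.const L (c i)) Term.var)
  refine ⟨ψ', hψ', fun N hN a => ?_⟩
  have hsubst : (fun i => (Fin.append (fun i => Term.const L (c i)) Term.var i).eval N a) =
      Fin.append (fun i => N.const (c i)) a := by
    funext i
    refine Fin.addCases (fun i => ?_) (fun i => ?_) i
    · simp only [Fin.append_left, Term.eval_const]
    · simp only [Fin.append_right, Term.eval]
  rw [hφ', heval, hsubst]
  exact happrox N.reduct (hM.reduct_of_elemDiagram hN) _

end Diagram

end ContLogic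

theorem proposition3p2 (L : ContLogic.Signature.{u, v}) (T : ContLogic.Theory L)
    (hT : ContLogic.Theory.IsComplete.{u, v, max u v w} T)
    (hmc : ContLogic.Theory.IsModelComplete.{u, v, max u v w} T)
    (hprim : ContLogic.Theory.IsPrimitive.{u, v, max u v w} T)
    (M : ContLogic.Structure.{u, v, max u v w} L) (hM : M.Models T) :
    -- `T_M` is universally axiomatizable
    ContLogic.Theory.IsUniversallyAxiomatizable.{max u v w, v, max u v w} M.elemDiagram ∧
    -- namely by `Γ` together with the atomic diagram of `M`
    (∀ Γ Δ : ContLogic.Theory L,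
      (∀ σ ∈ Γ, ContLogic.Sentence.IsUniversal σ) →
      (∀ σ ∈ Δ, ContLogic.Sentence.IsExistential σ) →
      ContLogic.Theory.Axiomatizes.{u, v, max u v w} (Γ ∪ Δ) T →
      ContLogic.Theory.Axiomatizes.{max u v w, v, max u v w}
        (ContLogic.Formula.lift M.Carrier '' Γ ∪ M.atomicDiagram) M.elemDiagram) ∧
    -- quantifier elimination passes from `T` to `T_M`
    (ContLogic.Theory.HasQE.{u, v, max u v w} T →
      ContLogic.Theory.HasQE.{max u v w, v, max u v w} M.elemDiagram) := by
  have key := fun Γ Δ : ContLogic.Theory L => fun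
      (_ : ∀ σ ∈ Γ, ContLogic.Sentence.IsUniversal σ)
      (hΔ : ∀ σ ∈ Δ, ContLogic.Sentence.IsExistential σ)
      (h : ContLogic.Theory.Axiomatizes.{u, v, max u v w} (Γ ∪ Δ) T) =>
    ContLogic.Theory.IsModelComplete.axiomatizes_elemDiagram.{u, v, max v w} hmc hM hΔ h
  refine ⟨?_, key, fun hQE => ContLogic.Theory.HasQE.elemDiagram.{u, v, max v w} hQE hM⟩
  obtain ⟨Γ, Δ, hΓ, hΔ, h⟩ := hprim
  refine ⟨_, ?_, key Γ Δ hΓ hΔ h⟩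
  rintro _ (⟨σ, hσ, rfl⟩ | hσ)
  · exact (hΓ σ hσ).lift
  · exact ContLogic.Structure.isUniversal_of_mem_atomicDiagram hσ
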